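/- There is an absolute constant $C>0$ such that the following holds. Let $\mathcal X$ be an instance space and $\mathcal Y=\{\pm1\}$, let $\mathcal H\subseteq\mathcal Y^{\mathcal X}$ be any class of measurable predictors, $\mathcal T$ any countable collection of measurable transformations $T:\mathcal X\to\mathcal X$, and $\mathcal D$ any probability distribution on $\mathcal X\times\mathcal Y$. Put $\mathcal H\circ\mathcal T=\{h\circ T: h\in\mathcal H,\,T\in\mathcal T\}$ and let $d=\mathrm{vc}(\mathcal H\circ\mathcal T)$ be its VC dimension, assumed finite. Assume the usual measurability convention on $\mathcal H\circ\mathcal T$: for each $n$ and each $s\in\mathcal Y^n$, the set of $(x_1,\dots,x_n)\in\mathcal X^n$ for which some $f\in\mathcal H\circ\mathcal T$ has $f(x_i)=s_i$ for all $i$ is measurable up to null sets of the $n$-fold product of the $\mathcal X$-marginal of $\mathcal D$. Write $\mathrm{err}(h,T(\mathcal D))=\Pr_{(x,y)\sim\mathcal D}[h(T(x))\ne y]$ and, for a sample $S=((x_1,y_1),\dots,(x_m,y_m))$, $\mathrm{err}(h,T(S))=\frac1m\sum_{i=1}^m\mathbb 1[h(T(x_i))\ne y_i]$. Let $\varepsilon,\delta\in(0,1)$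 and let $m$ be any integer with $$m\ \ge\ C\,\frac{d\log(1/\varepsilon)+\log(1/\delta)}{\varepsilon}.$$ Then with probability at least $1-\delta$ over $S\sim\mathcal D^m$, every $\hat h\in\arg\max_{h\in\mathcal H}\sum_{T\in\mathcal T}\mathbb 1[\mathrm{err}(h,T(S))\le\varepsilon]$ satisfies $$\sum_{T\in\mathcal T}\mathbb 1[\mathrm{err}(\hat h,T(\mathcal D))\le3\varepsilon]\ \ge\ \sup_{h^\star\in\mathcal H}\sum_{T\in\mathcal T}\mathbb 1\left[\mathrm{err}(h^\star,T(\mathcal D))\le\tfrac{\varepsilon}{3}\right]$$ (sums with values in $[0,\infty]$) and, if moreover $\varepsilon\le\frac12$, for every $T\in\mathcal T$, $$\mathrm{err}(\hat h,T(\mathcal D))\ \le\ \mathrm{err}(\hat h,T(S))+\sqrt{\mathrm{err}(\hat h,T(S))\,\tfrac{\varepsilon}{3}}+\tfrac{\varepsilon}{3}.$$ -/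

import Mathlib

open MeasureTheory
open scoped ENNReal

namespace TransformLearning

noncomputable section

/-- The composed class `H ∘ 𝒯 = {h ∘ T : h ∈ H, T ∈ 𝒯}`. The label space `{±1}` is modelled by
`Bool`. -/
def compClass {X : Type*} (H : Set (X → Bool)) (𝒯 : Set (X → X)) : Set (X → Bool) :=
  {f | ∃ h ∈ H, ∃ T ∈ 𝒯, f = h ∘ T}

/-- `F` shatters the finite set `s`: every labelling of `s` is realized by a member of `F`. -/
def ClassShatters {X : Type*} (F : Set (X → Bool)) (s : Finset X) : Prop :=
  ∀ g : X → Bool, ∃ f ∈ F, ∀ x ∈ s, f x = g x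

/-- The VC dimension: the supremum of the cardinalities of the shattered finite sets. -/
def vcDimension {X : Type*} (F : Set (X → Bool)) : ℕ∞ :=
  ⨆ s : {s : Finset X // ClassShatters F s}, (s.1.card : ℕ∞)

/-- `err(h, T(D)) = P_{(x,y) ∼ D} [h (T x) ≠ y]`. -/
def err {X : Type*} [MeasurableSpace X] (D : Measure (X × Bool)) (h : X → Bool) (T : X → X) : ℝ :=
  D.real {z | h (T z.1) ≠ z.2}

/-- `err(h, T(S)) = (1/m) ∑ᵢ 1[h (T xᵢ) ≠ yᵢ]` for the sample `S = ((x₁,y₁), …, (xₘ,yₘ))`. -/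
def empErr {X : Type*} {m : ℕ} (S : Fin m → X × Bool) (h : X → Bool) (T : X → X) : ℝ :=
  (∑ i, if h (T (S i).1) ≠ (S i).2 then (1 : ℝ) else 0) / m

/-- `∑_{T ∈ 𝒯} 1[e T ≤ c]`, with value `∞` if infinitely many `T` satisfy `e T ≤ c`. -/
def countLE {X : Type*} (𝒯 : Set (X → X)) (e : (X → X) → ℝ) (c : ℝ) : ℝ≥0∞ :=
  ∑' T : 𝒯, if e T ≤ c then 1 else 0

/-- The predictors that the learning rule may output on the sample `S`: the members of `H` that
maximize the number of transformations with empirical error at most `ε`. -/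
def learningRule {X : Type*} {m : ℕ} (H : Set (X → Bool)) (𝒯 : Set (X → X)) (ε : ℝ)
    (S : Fin m → X × Bool) : Set (X → Bool) :=
  {h | h ∈ H ∧ IsMaxOn (fun h' => countLE 𝒯 (empErr S h') ε) H h}

/-- The measurability convention on a class `F` of predictors under the marginal `P` on instances:
for each labelling `s` of `n` points, the set of the `n`-tuples on which some member of `F` realizes
`s` is measurable up to null sets. It holds for countable and for pointwise separable classes of
measurable functions. Some convention of this kind is necessary: on uncountable well-ordered sets
there are classes of measurable functions of VC dimension 1 without uniform convergence. -/
def MeasurablyRealizes {X : Type*} [MeasurableSpace X] (P : Measure X) (F : Set (X → Bool)) :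
    Prop :=
  ∀ (n : ℕ) (s : Fin n → Bool),
    NullMeasurableSet {x : Fin n → X | ∃ f ∈ F, ∀ i, f (x i) = s i} (Measure.pi fun _ => P)

end

end TransformLearning

open TransformLearning

namespace TransformLearning

/-! The proof is relative uniform convergence for `compClass H 𝒯` at scale `e = ε / 3`. Outside an
event of probability at most `δ`, every `f` in the class has `freq ≥ risk - √(risk * e)`, and `freq
≤ 3 * e` whenever `risk ≤ e`. The first inequality inverts to `risk ≤ freq + √(freq * e) + e`, the
last claim of the theorem, and gives `risk ≤ 9 * e` when `freq ≤ 3 * e`. So a transformation good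
for a competitor at level `ε / 3` is counted empirically at level `ε`, the learner maximizes that
count, and whatever it counts has risk at most `3 * ε`.

The uniform statement (`measure_relative_deviation_le`) comes from symmetrization. If `f` misbehaves
on `S`, an independent ghost sample behaves well with probability at least `1 / 2` (Chernoff or
Markov for this single `f`), and then the two loss vectors satisfy `Deviates`. This condition is
self-normalized: random exchanges between the two samples put random signs on the loss differences
and leave their squares unchanged, so a subgaussian bound for Rademacher sums gives a tail depending
on `c` alone (`card_signed_sum_sq_ge_le`). A union bound over the labellings of the `2m` points,
counted by Sauer–Shelah, finishes the estimate. -/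

/-! ### Growth function and Sauer–Shelah. -/

open Classical in
/-- The labellings of the points `x i` that are realized by members of `F`. -/
noncomputable def realized {X ι : Type*} [Fintype ι] (F : Set (X → Bool)) (x : ι → X) :
    Finset (ι → Bool) :=
  Finset.univ.filter fun v => ∃ f ∈ F, ∀ i, f (x i) = v i

lemma mem_realized {X ι : Type*} [Fintype ι] {F : Set (X → Bool)} {x : ι → X} {v : ι → Bool} :
    v ∈ realized F x ↔ ∃ f ∈ F, ∀ i, f (x i) = v i := by
  simp [realized]

lemma ClassShatters.card_le {X : Type*} {F : Set (X → Bool)} {d : ℕ}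
    (hd : vcDimension F ≤ d) {s : Finset X} (hs : ClassShatters F s) : s.card ≤ d := by
  have h := le_trans (le_iSup (fun s : {s : Finset X // ClassShatters F s} => (s.1.card : ℕ∞))
    ⟨s, hs⟩) hd
  exact_mod_cast h

/-- The Sauer–Shelah bound for the number of realized labellings. -/
lemma card_realized_le {X ι : Type*} [Fintype ι] {F : Set (X → Bool)} {d : ℕ}
    (hd : vcDimension F ≤ d) (x : ι → X) :
    (realized F x).card ≤ ∑ k ∈ Finset.Iic d, (Fintype.card ι).choose k := by
  classical
  let toSet : (ι → Bool) → Finset ι := fun v => Finset.univ.filter fun i => v i = true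
  have mem_toSet : ∀ v i, i ∈ toSet v ↔ v i = true := fun v i => by simp [toSet]
  have hinj : Function.Injective toSet := by
    intro v w hvw
    funext i
    have := congrArg (i ∈ ·) hvw
    simp only [mem_toSet, eq_iff_iff] at this
    exact Bool.eq_iff_iff.2 this
  set A := (realized F x).image toSet with hA
  rw [← Finset.card_image_of_injective (realized F x) hinj, ← hA]
  refine (A.card_le_card_shatterer.trans A.card_shatterer_le_sum_vcDim).trans ?_
  refine Finset.sum_le_sum_of_subset (Finset.Iic_subset_Iic.2 ?_)
  refine Finset.sup_le fun I hI => ?_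
  rw [Finset.mem_shatterer] at hI
  have hreal : ∀ t ⊆ I, ∃ f ∈ F, ∀ i ∈ I, (f (x i) = true ↔ i ∈ t) := by
    intro t ht
    obtain ⟨u, hu, hut⟩ := hI ht
    obtain ⟨v, hv, rfl⟩ := Finset.mem_image.1 hu
    obtain ⟨f, hf, hfv⟩ := mem_realized.1 hv
    refine ⟨f, hf, fun i hi => ?_⟩
    rw [hfv i, ← hut, Finset.mem_inter, mem_toSet]
    simp [hi]
  -- Sauer–Shelah is applied to sets of indices, since the points `x i` may repeat. On a shattered
  -- index set they cannot: some `f` separates `x i` from `x j`.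
  have hxinj : Set.InjOn x (I : Set ι) := by
    intro i hi j hj hij
    obtain ⟨f, -, hf⟩ := hreal {i} (by simpa using hi)
    have h1 := hf i hi
    have h2 := hf j hj
    rw [← hij, h1] at h2
    simpa [eq_comm] using h2
  rw [← Finset.card_image_of_injOn hxinj]
  refine ClassShatters.card_le hd fun g => ?_
  obtain ⟨f, hf, hfi⟩ := hreal (I.filter fun i => g (x i) = true) (Finset.filter_subset _ _)
  refine ⟨f, hf, fun y hy => ?_⟩
  obtain ⟨i, hi, rfl⟩ := Finset.mem_image.1 hy
  have := hfi i hi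
  rw [Finset.mem_filter] at this
  exact Bool.eq_iff_iff.2 (this.trans (by simp [hi]))

/-- Weighting by `l ^ d ≤ l ^ k` turns the sum into part of the binomial expansion of `(l + 1) ^ n`.
The parameter `l` stays free so that the factor `exp (n * l)` can later be absorbed by the deviation
bound. -/
lemma sum_choose_le_exp (n d : ℕ) {l : ℝ} (hl : 0 < l) (hl1 : l ≤ 1) :
    ((∑ k ∈ Finset.Iic d, n.choose k : ℕ) : ℝ) ≤ (1 / l) ^ d * Real.exp (n * l) := by
  have h1 : ((∑ k ∈ Finset.Iic d, n.choose k : ℕ) : ℝ) * l ^ d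
      ≤ ∑ k ∈ Finset.Iic d, l ^ k * (n.choose k : ℝ) := by
    push_cast
    rw [Finset.sum_mul]
    refine Finset.sum_le_sum fun k hk => ?_
    rw [mul_comm]
    exact mul_le_mul_of_nonneg_right
      (pow_le_pow_of_le_one hl.le hl1 (Finset.mem_Iic.1 hk)) (by positivity)
  have h2 : ∑ k ∈ Finset.Iic d, l ^ k * (n.choose k : ℝ) ≤ (l + 1) ^ n := by
    rw [add_pow]
    simp only [one_pow, mul_one]
    have h3 : ∑ k ∈ Finset.Iic d, l ^ k * (n.choose k : ℝ)
        ≤ ∑ k ∈ Finset.Iic d ∪ Finset.range (n + 1), l ^ k * (n.choose k : ℝ) :=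
      Finset.sum_le_sum_of_subset_of_nonneg Finset.subset_union_left
        fun _ _ _ => by positivity
    refine h3.trans (le_of_eq ?_)
    symm
    refine Finset.sum_subset Finset.subset_union_right fun k _ hk => ?_
    rw [Finset.mem_range, not_lt] at hk
    rw [Nat.choose_eq_zero_of_lt (by omega)]
    simp
  have h3 : (l + 1) ^ n ≤ Real.exp (n * l) := by
    rw [Real.exp_nat_mul]
    exact pow_le_pow_left₀ (by positivity) (Real.add_one_le_exp l) n
  have h4 := h1.trans (h2.trans h3)
  rw [one_div, inv_pow, inv_mul_eq_div, le_div_iff₀ (by positivity)]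
  exact h4

/-! ### Rademacher sums. -/

/-- `x` or `-x`, according to the sign bit. -/
def signed (s : Bool) (x : ℝ) : ℝ := if s then -x else x

/-- The sum over sign vectors factors over coordinates, and each factor is `2 * cosh (t * a i) ≤ 2 *
exp ((t * a i) ^ 2 / 2)`. -/
lemma sum_exp_signed_le {ι : Type*} [Fintype ι] [DecidableEq ι] (a : ι → ℝ) (t : ℝ) :
    ∑ s : ι → Bool, Real.exp (t * ∑ i, signed (s i) (a i))
      ≤ 2 ^ Fintype.card ι * Real.exp (t ^ 2 * (∑ i, a i ^ 2) / 2) := by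
  have h1 : ∀ s : ι → Bool, Real.exp (t * ∑ i, signed (s i) (a i))
      = ∏ i, Real.exp (t * signed (s i) (a i)) := fun s => by
    rw [Finset.mul_sum, Real.exp_sum]
  simp_rw [h1]
  rw [← Fintype.prod_sum (fun i (b : Bool) => Real.exp (t * signed b (a i)))]
  have h2 : ∀ i, ∑ b : Bool, Real.exp (t * signed b (a i)) ≤ 2 * Real.exp ((t * a i) ^ 2 / 2) := by
    intro i
    have := Real.cosh_le_exp_half_sq (t * a i)
    rw [Real.cosh_eq] at this
    simp only [Fintype.sum_bool, signed, if_true, Bool.false_eq_true, if_false, mul_neg]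
    linarith
  refine (Finset.prod_le_prod (fun i _ => by positivity) fun i _ => h2 i).trans (le_of_eq ?_)
  rw [Finset.prod_mul_distrib, Finset.prod_const, Finset.card_univ, ← Real.exp_sum]
  congr 2
  rw [Finset.mul_sum, Finset.sum_div]
  exact Finset.sum_congr rfl fun i _ => by ring

open Classical in
/-- Self-normalized tail bound for Rademacher sums. -/
lemma card_signed_sum_sq_ge_le {ι : Type*} [Fintype ι] [DecidableEq ι] (a : ι → ℝ) {c : ℝ} (hc : 0 ≤ c) :
    (((Finset.univ : Finset (ι → Bool)).filter fun s =>
      ∑ i, signed (s i) (a i) ≠ 0 ∧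
        c * ∑ i, a i ^ 2 ≤ (∑ i, signed (s i) (a i)) ^ 2).card : ℝ)
      ≤ 2 ^ Fintype.card ι * (2 * Real.exp (-(c / 2))) := by
  set V := ∑ i, a i ^ 2 with hV
  rcases (Finset.sum_nonneg fun i (_ : i ∈ Finset.univ) => sq_nonneg (a i)).eq_or_lt with h0 | hpos
  -- Here the quadratic inequality reads `0 ≤ 0`; only the nonvanishing clause makes the event
  -- empty.
  · have ha : ∀ i, a i = 0 := fun i => by
      have := (Finset.sum_eq_zero_iff_of_nonneg fun i _ => sq_nonneg (a i)).1 h0.symm i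
        (Finset.mem_univ i)
      exact pow_eq_zero_iff two_ne_zero |>.1 this
    rw [Finset.filter_false_of_mem]
    · simp only [Finset.card_empty, Nat.cast_zero]
      positivity
    · intro s _ h
      exact h.1 (Finset.sum_eq_zero fun i _ => by simp [signed, ha i])
  · rw [← hV] at hpos
    -- With `t ^ 2 * V = c` the event forces `|t * Y| ≥ c`, while each exponential moment is at most
    -- `exp (c / 2)` on average. The two signs of `Y` give the factor 2.
    set t := Real.sqrt (c / V) with ht
    have ht0 : 0 ≤ t := Real.sqrt_nonneg _
    have ht2 : t ^ 2 * V = c := by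
      rw [ht, Real.sq_sqrt (by positivity)]
      field_simp
    have hp := sum_exp_signed_le a t
    have hm := sum_exp_signed_le a (-t)
    rw [neg_sq, ← hV, ht2] at hm
    rw [← hV, ht2] at hp
    set B := (Finset.univ : Finset (ι → Bool)).filter fun s =>
      ∑ i, signed (s i) (a i) ≠ 0 ∧ c * V ≤ (∑ i, signed (s i) (a i)) ^ 2 with hB
    have key : (B.card : ℝ) * Real.exp c ≤ ∑ s : ι → Bool,
        (Real.exp (t * ∑ i, signed (s i) (a i)) + Real.exp (-t * ∑ i, signed (s i) (a i))) := by
      rw [← nsmul_eq_mul, ← Finset.sum_const]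
      refine le_trans (Finset.sum_le_sum fun s hs => ?_)
        (Finset.sum_le_sum_of_subset_of_nonneg (Finset.subset_univ B) fun _ _ _ => by positivity)
      obtain ⟨-, -, h⟩ := Finset.mem_filter.1 hs
      set Y := ∑ i, signed (s i) (a i)
      have hY : c ≤ |t * Y| := by
        refine le_of_sq_le_sq ?_ (abs_nonneg _)
        rw [sq_abs, mul_pow]
        calc c ^ 2 = t ^ 2 * (c * V) := by rw [← ht2]; ring
          _ ≤ t ^ 2 * Y ^ 2 := by gcongr
      have e1 := Real.exp_pos (t * Y)
      have e2 := Real.exp_pos (-t * Y)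
      rcases le_abs.1 hY with h | h
      · linarith [Real.exp_le_exp.2 h]
      · rw [← neg_mul] at h
        linarith [Real.exp_le_exp.2 h]
    rw [Finset.sum_add_distrib] at key
    have hce : Real.exp (c / 2) = Real.exp c * Real.exp (-(c / 2)) := by
      rw [← Real.exp_add]; ring_nf
    rw [hce] at hp hm
    refine le_of_mul_le_mul_right ?_ (Real.exp_pos c)
    linarith
-- Symmetrization on a double sample.
/-- The indicator of a bit, as a real number. -/
def ind (b : Bool) : ℝ := if b then 1 else 0

lemma ind_nonneg (b : Bool) : 0 ≤ ind b := by cases b <;> simp [ind]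

/-- The errors of `f` on the labelled sample `S`. -/
def loss {X ι : Type*} (f : X → Bool) (S : ι → X × Bool) (i : ι) : Bool := f (S i).1 != (S i).2

/-- Two loss vectors deviate: their totals differ, by much compared to the number of positions at
which they differ. -/
def Deviates {ι : Type*} [Fintype ι] (c : ℝ) (u v : ι → Bool) : Prop :=
  ∑ i, (ind (v i) - ind (u i)) ≠ 0 ∧
    c * ∑ i, (ind (v i) - ind (u i)) ^ 2 ≤ (∑ i, (ind (v i) - ind (u i))) ^ 2

/-- The double samples on which some member of `F` has deviating loss vectors. -/
def doubleDeviation {X ι : Type*} [Fintype ι] (F : Set (X → Bool)) (c : ℝ) :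
    Set ((ι → X × Bool) × (ι → X × Bool)) :=
  {w | ∃ f ∈ F, Deviates c (loss f w.1) (loss f w.2)}

/-- Exchange the entries of a pair of vectors at the positions marked by `s`. -/
def swapPair {Z ι : Type*} (s : ι → Bool) (w : (ι → Z) × (ι → Z)) : (ι → Z) × (ι → Z) :=
  (fun i => if s i then w.2 i else w.1 i, fun i => if s i then w.1 i else w.2 i)

/-- Viewed as a vector of pairs, the double sample is i.i.d. with law `D.prod D`, and the exchange
acts coordinatewise by `Prod.swap` or the identity. -/
lemma measurePreserving_swapPair {Z ι : Type*} [MeasurableSpace Z] [Fintype ι]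
    (D : Measure Z) [SigmaFinite D] (s : ι → Bool) :
    MeasurePreserving (swapPair (Z := Z) s)
      ((Measure.pi fun _ : ι => D).prod (Measure.pi fun _ : ι => D))
      ((Measure.pi fun _ : ι => D).prod (Measure.pi fun _ : ι => D)) := by
  have h := measurePreserving_arrowProdEquivProdArrow Z Z ι (fun _ => D) (fun _ => D)
  have hs : MeasurePreserving
      (fun (ω : ι → Z × Z) i => (if s i then Prod.swap else id : Z × Z → Z × Z) (ω i))
      (Measure.pi fun _ => D.prod D) (Measure.pi fun _ => D.prod D) := by
    refine measurePreserving_pi _ _ fun i => ?_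
    cases s i
    · exact MeasurePreserving.id _
    · exact Measure.measurePreserving_swap
  convert! (h.comp hs).comp (h.symm) using 1
  funext w
  refine Prod.ext (funext fun i => ?_) (funext fun i => ?_)
  · change (if s i then w.2 i else w.1 i)
      = ((if s i then Prod.swap else id : Z × Z → Z × Z) (w.1 i, w.2 i)).1
    cases s i <;> rfl
  · change (if s i then w.1 i else w.2 i)
      = ((if s i then Prod.swap else id : Z × Z → Z × Z) (w.1 i, w.2 i)).2
    cases s i <;> rfl

lemma measurePreserving_append {Z : Type*} [MeasurableSpace Z] (D : Measure Z) [SigmaFinite D]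
    (m n : ℕ) :
    MeasurePreserving (fun w : (Fin m → Z) × (Fin n → Z) => Fin.append w.1 w.2)
      ((Measure.pi fun _ => D).prod (Measure.pi fun _ => D)) (Measure.pi fun _ => D) where
  measurable := by
    refine measurable_pi_iff.2 fun i => ?_
    refine Fin.addCases (fun i => ?_) (fun i => ?_) i
    · simp only [Fin.append_left]; fun_prop
    · simp only [Fin.append_right]; fun_prop
  map_eq := by
    have hm : Measurable (fun w : (Fin m → Z) × (Fin n → Z) => Fin.append w.1 w.2) := by
      refine measurable_pi_iff.2 fun i => ?_
      refine Fin.addCases (fun i => ?_) (fun i => ?_) i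
      · simp only [Fin.append_left]; fun_prop
      · simp only [Fin.append_right]; fun_prop
    refine (Measure.pi_eq fun s hs => ?_).symm
    rw [Measure.map_apply hm (MeasurableSet.univ_pi hs)]
    have : (fun w : (Fin m → Z) × (Fin n → Z) => Fin.append w.1 w.2) ⁻¹' Set.univ.pi s
        = (Set.univ.pi fun i => s (Fin.castAdd n i)) ×ˢ
          (Set.univ.pi fun i => s (Fin.natAdd m i)) := by
      ext w
      simp only [Set.mem_preimage, Set.mem_pi, Set.mem_univ, true_implies, Set.mem_prod]
      constructor
      · exact fun h => ⟨fun i => by simpa using h (Fin.castAdd n i),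
          fun i => by simpa using h (Fin.natAdd m i)⟩
      · rintro ⟨h1, h2⟩ i
        refine Fin.addCases (fun i => ?_) (fun i => ?_) i
        · simpa using h1 i
        · simpa using h2 i
    rw [this, Measure.prod_prod, Measure.pi_pi, Measure.pi_pi, Fin.prod_univ_add]

/-- Whether a deviation occurs depends only on the predicted and true labels at the `2m` points. The
event is thus a finite union over both labellings, and the convention is applied to the concatenated
sample of length `m + m`. -/
lemma nullMeasurableSet_doubleDeviation {X : Type*} [MeasurableSpace X] {F : Set (X → Bool)}
    (D : Measure (X × Bool)) [IsProbabilityMeasure D] (hF : MeasurablyRealizes D.fst F)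
    (m : ℕ) (c : ℝ) :
    NullMeasurableSet (doubleDeviation (ι := Fin m) F c)
      ((Measure.pi fun _ => D).prod (Measure.pi fun _ => D)) := by
  have hfst : MeasurePreserving (fun (z : Fin (m + m) → X × Bool) i => (z i).1)
      (Measure.pi fun _ => D) (Measure.pi fun _ => D.fst) :=
    measurePreserving_pi (fun _ => D) (fun _ => D.fst) fun _ => ⟨measurable_fst, rfl⟩
  have key : ∀ v y : Fin (m + m) → Bool, NullMeasurableSet
      {z : Fin (m + m) → X × Bool | (∃ f ∈ F, ∀ i, f (z i).1 = v i) ∧ (∀ i, (z i).2 = y i) ∧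
        Deviates c (fun i : Fin m => v (Fin.castAdd m i) != y (Fin.castAdd m i))
          (fun i : Fin m => v (Fin.natAdd m i) != y (Fin.natAdd m i))}
      (Measure.pi fun _ => D) := by
    intro v y
    refine ((hF (m + m) v).preimage hfst.quasiMeasurePreserving).inter
      (NullMeasurableSet.inter (MeasurableSet.nullMeasurableSet ?_) (.const _))
    change MeasurableSet {z : Fin (m + m) → X × Bool | ∀ i, (z i).2 = y i}
    have : {z : Fin (m + m) → X × Bool | ∀ i, (z i).2 = y i} =
        ⋂ i, (fun z : Fin (m + m) → X × Bool => (z i).2) ⁻¹' {y i} := by ext; simp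
    rw [this]
    exact MeasurableSet.iInter fun i => (by fun_prop : Measurable _) (measurableSet_singleton _)
  have hU := NullMeasurableSet.iUnion fun v => NullMeasurableSet.iUnion fun y => key v y
  convert! hU.preimage (measurePreserving_append D m m).quasiMeasurePreserving using 1
  ext w
  simp only [doubleDeviation, Set.mem_ofPred_eq, Set.mem_preimage, Set.mem_iUnion]
  constructor
  · rintro ⟨f, hf, h⟩
    refine ⟨fun i => f (Fin.append w.1 w.2 i).1, fun i => (Fin.append w.1 w.2 i).2,
      ⟨f, hf, fun _ => rfl⟩, fun _ => rfl, ?_⟩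
    simp only [Fin.append_left, Fin.append_right]
    exact h
  · rintro ⟨v, y, ⟨f, hf, hv⟩, hy, h⟩
    refine ⟨f, hf, ?_⟩
    simp only [← hv, ← hy, Fin.append_left, Fin.append_right] at h
    exact h

lemma ind_sub_swap {X ι : Type*} (f : X → Bool) (w : (ι → X × Bool) × (ι → X × Bool))
    (s : ι → Bool) (i : ι) :
    ind (loss f (swapPair s w).2 i) - ind (loss f (swapPair s w).1 i)
      = signed (s i) (ind (loss f w.2 i) - ind (loss f w.1 i)) := by
  simp only [loss, swapPair, signed]
  cases s i <;> simp

lemma signed_sq (s : Bool) (x : ℝ) : signed s x ^ 2 = x ^ 2 := by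
  cases s <;> simp [signed]

-- For a fixed double sample, `f` matters only through its labelling of the `2m` points, which
-- exchanges do not alter. Hence at most `N` Rademacher events have to be united.
open Classical in
lemma card_swap_mem_doubleDeviation_le {X ι : Type*} [Fintype ι] [DecidableEq ι]
    {F : Set (X → Bool)} {N : ℕ}
    (hN : ∀ x : ι ⊕ ι → X, (realized F x).card ≤ N) {c : ℝ} (hc : 0 ≤ c)
    (w : (ι → X × Bool) × (ι → X × Bool)) :
    (((Finset.univ : Finset (ι → Bool)).filter fun s =>
      swapPair s w ∈ doubleDeviation F c).card : ℝ)
      ≤ N * (2 ^ Fintype.card ι * (2 * Real.exp (-(c / 2)))) := by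
  let x : ι ⊕ ι → X := Sum.elim (fun i => (w.1 i).1) (fun i => (w.2 i).1)
  let a : (ι ⊕ ι → Bool) → ι → ℝ := fun v i =>
    ind (v (.inr i) != (w.2 i).2) - ind (v (.inl i) != (w.1 i).2)
  let B : (ι ⊕ ι → Bool) → Finset (ι → Bool) := fun v => Finset.univ.filter fun s =>
      ∑ i, signed (s i) (a v i) ≠ 0 ∧
        c * ∑ i, a v i ^ 2 ≤ (∑ i, signed (s i) (a v i)) ^ 2
  have hsub : ((Finset.univ : Finset (ι → Bool)).filter fun s =>
      swapPair s w ∈ doubleDeviation F c) ⊆ (realized F x).biUnion B := by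
    intro s hs
    obtain ⟨f, hf, h⟩ := (Finset.mem_filter.1 hs).2
    refine Finset.mem_biUnion.2 ⟨fun j => f (x j), mem_realized.2 ⟨f, hf, fun _ => rfl⟩,
      Finset.mem_filter.2 ⟨Finset.mem_univ _, ?_⟩⟩
    simp only [Deviates, ind_sub_swap, signed_sq] at h
    exact h
  have h1 := (Finset.card_le_card hsub).trans Finset.card_biUnion_le
  have h2 : ((∑ v ∈ realized F x, (B v).card : ℕ) : ℝ)
      ≤ (realized F x).card * (2 ^ Fintype.card ι * (2 * Real.exp (-(c / 2)))) := by
    push_cast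
    rw [← nsmul_eq_mul]
    exact Finset.sum_le_card_nsmul _ _ _ fun v _ => card_signed_sum_sq_ge_le (a v) hc
  refine (Nat.cast_le.2 h1).trans (h2.trans ?_)
  have := hN x
  gcongr

/-- The probability of a double deviation, by symmetrization. -/
lemma measure_doubleDeviation_le {X : Type*} [MeasurableSpace X] {F : Set (X → Bool)}
    (D : Measure (X × Bool)) [IsProbabilityMeasure D] (hF : MeasurablyRealizes D.fst F)
    {m N : ℕ} (hN : ∀ x : Fin m ⊕ Fin m → X, (realized F x).card ≤ N) {c : ℝ} (hc : 0 ≤ c) :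
    ((Measure.pi fun _ : Fin m => D).prod (Measure.pi fun _ => D)) (doubleDeviation F c)
      ≤ ENNReal.ofReal (N * (2 * Real.exp (-(c / 2)))) := by
  classical
  set μ := (Measure.pi fun _ : Fin m => D).prod (Measure.pi fun _ : Fin m => D) with hμ
  set E := doubleDeviation (ι := Fin m) F c with hE
  have hEm : NullMeasurableSet E μ := nullMeasurableSet_doubleDeviation D hF m c
  have hpre : ∀ s : Fin m → Bool, NullMeasurableSet (swapPair s ⁻¹' E) μ := fun s =>
    hEm.preimage (measurePreserving_swapPair D s).quasiMeasurePreserving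
  -- All `2 ^ m` exchanges preserve the measure, so the probability of `E` is the average over `w`
  -- of the fraction of exchanges taking `w` into `E`, which is bounded pointwise.
  have h1 : ∑ s : Fin m → Bool, μ (swapPair s ⁻¹' E) = 2 ^ m * μ E := by
    rw [Finset.sum_congr rfl fun s _ => (measurePreserving_swapPair D s).measure_preimage hEm]
    simp [hμ]
  have h2 : ∑ s : Fin m → Bool, μ (swapPair s ⁻¹' E)
      = ∫⁻ w, ∑ s : Fin m → Bool, (swapPair s ⁻¹' E).indicator 1 w ∂μ := by
    refine Eq.trans ?_ (lintegral_finsetSum' _ fun s _ =>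
      (aemeasurable_one.indicator₀ (hpre s) :
        AEMeasurable ((swapPair s ⁻¹' E).indicator 1) μ)).symm
    exact Finset.sum_congr rfl fun s _ => (lintegral_indicator_one₀ (hpre s)).symm
  have h3 : ∀ w, ∑ s : Fin m → Bool, (swapPair s ⁻¹' E).indicator (1 : (Fin m → X × Bool) × (Fin m → X × Bool) → ℝ≥0∞) w
      ≤ ENNReal.ofReal (N * (2 ^ m * (2 * Real.exp (-(c / 2))))) := by
    intro w
    have h := card_swap_mem_doubleDeviation_le hN hc w
    rw [Fintype.card_fin] at h
    refine le_trans (le_of_eq ?_) (ENNReal.ofReal_le_ofReal h)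
    rw [ENNReal.ofReal_natCast, Finset.card_filter]
    push_cast
    exact Finset.sum_congr rfl fun s _ => by simp [Set.indicator_apply, hE]
  have h4 : 2 ^ m * μ E ≤ ENNReal.ofReal (N * (2 ^ m * (2 * Real.exp (-(c / 2))))) := by
    rw [← h1, h2]
    exact (lintegral_mono h3).trans (by rw [lintegral_const]; simp [hμ])
  have h5 : ENNReal.ofReal (N * (2 ^ m * (2 * Real.exp (-(c / 2)))))
      = 2 ^ m * ENNReal.ofReal (N * (2 * Real.exp (-(c / 2)))) := by
    rw [mul_left_comm, ENNReal.ofReal_mul (by positivity), ENNReal.ofReal_pow (by norm_num)]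
    simp
  rw [h5] at h4
  exact (ENNReal.mul_le_mul_iff_right (by positivity) (by finiteness)).1 h4

/-- Passing to a ghost sample, for sets that need not be measurable. -/
lemma measure_le_two_mul_prod {α : Type*} [MeasurableSpace α] (μ : Measure α) [SFinite μ]
    {A : Set α} {E : Set (α × α)}
    (h : ∀ x ∈ A, ∃ G : Set α, 1 / 2 ≤ μ G ∧ ∀ y ∈ G, (x, y) ∈ E) :
    μ A ≤ 2 * μ.prod μ E := by
  -- Fubini needs a measurable set. The hull has the same measure as `E` and larger sections, so `A`
  -- itself may be arbitrary.
  set E' := toMeasurable (μ.prod μ) E with hE'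
  have hm : MeasurableSet E' := measurableSet_toMeasurable _ _
  rw [← measure_toMeasurable E, ← hE', Measure.prod_apply hm]
  have hA : A ⊆ {x | 1 / 2 ≤ μ (Prod.mk x ⁻¹' E')} := by
    intro x hx
    obtain ⟨G, hG, hGE⟩ := h x hx
    exact hG.trans (measure_mono fun y hy => subset_toMeasurable _ _ (hGE y hy))
  have := mul_meas_ge_le_lintegral (μ := μ) (measurable_measure_prodMk_left (ν := μ) hm) (1 / 2)
  calc μ A ≤ μ {x | 1 / 2 ≤ μ (Prod.mk x ⁻¹' E')} := measure_mono hA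
    _ = 2 * (1 / 2 * μ {x | 1 / 2 ≤ μ (Prod.mk x ⁻¹' E')}) := by
      rw [← mul_assoc, one_div, ENNReal.mul_inv_cancel (by simp) (by simp), one_mul]
    _ ≤ _ := by gcongr

/-! ### Tail bounds for a single predictor. -/

/-- The probability that `f` errs. -/
noncomputable def risk {X : Type*} [MeasurableSpace X] (D : Measure (X × Bool)) (f : X → Bool) :
    ℝ :=
  D.real {z | f z.1 ≠ z.2}

/-- The error frequency of `f` on a sample. -/
noncomputable def freq {X : Type*} {m : ℕ} (f : X → Bool) (S : Fin m → X × Bool) : ℝ :=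
  (∑ i, ind (loss f S i)) / m

lemma err_eq_risk {X : Type*} [MeasurableSpace X] (D : Measure (X × Bool)) (h : X → Bool) (T : X → X) :
    err D h T = risk D (h ∘ T) := rfl

lemma empErr_eq_freq {X : Type*} {m : ℕ} (S : Fin m → X × Bool) (h : X → Bool) (T : X → X) :
    empErr S h T = freq (h ∘ T) S := by
  simp [empErr, freq, ind, loss]

lemma risk_nonneg {X : Type*} [MeasurableSpace X] {D : Measure (X × Bool)} {f : X → Bool} : 0 ≤ risk D f := measureReal_nonneg

lemma freq_nonneg {X : Type*} {f : X → Bool} {m : ℕ} (S : Fin m → X × Bool) : 0 ≤ freq f S :=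
  div_nonneg (Finset.sum_nonneg fun _ _ => ind_nonneg _) (Nat.cast_nonneg _)

lemma mul_freq {X : Type*} {f : X → Bool} {m : ℕ} (S : Fin m → X × Bool) : m * freq f S = ∑ i, ind (loss f S i) := by
  rcases Nat.eq_zero_or_pos m with rfl | hm
  · simp
  · rw [freq, mul_div_cancel₀]
    positivity

lemma measurable_ind_loss {X : Type*} [MeasurableSpace X] {f : X → Bool} (hf : Measurable f) :
    Measurable fun z : X × Bool => ind (f z.1 != z.2) :=
  (measurable_of_finite fun b : Bool × Bool => ind (b.1 != b.2)).comp
    ((hf.comp measurable_fst).prodMk measurable_snd)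

lemma integrable_ind_loss {X : Type*} [MeasurableSpace X] {D : Measure (X × Bool)}
    [IsProbabilityMeasure D] {f : X → Bool} (hf : Measurable f) :
    Integrable (fun z : X × Bool => ind (f z.1 != z.2)) D := by
  refine Integrable.of_bound (measurable_ind_loss hf).aestronglyMeasurable 1
    (Filter.Eventually.of_forall fun z => ?_)
  rw [Real.norm_eq_abs, abs_of_nonneg (ind_nonneg _), ind]
  split_ifs <;> norm_num

lemma integral_ind_loss {X : Type*} [MeasurableSpace X] {D : Measure (X × Bool)}
    {f : X → Bool} (hf : Measurable f) :
    ∫ z, ind (f z.1 != z.2) ∂D = risk D f := by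
  have hA : MeasurableSet {z : X × Bool | f z.1 ≠ z.2} :=
    (measurableSet_eq_fun (hf.comp measurable_fst) measurable_snd).compl
  rw [risk, ← integral_indicator_one hA]
  refine integral_congr_ae (Filter.Eventually.of_forall fun z => ?_)
  by_cases h : f z.1 = z.2 <;> simp [ind, h]

/-- Chernoff's bound for the lower tail. -/
lemma measure_freq_lt_le {X : Type*} [MeasurableSpace X] (D : Measure (X × Bool))
    [IsProbabilityMeasure D] {f : X → Bool} (hf : Measurable f)
    (m : ℕ) {a : ℝ} (ha : 0 ≤ a) :
    (Measure.pi fun _ : Fin m => D) {S | freq f S < risk D f - √(risk D f * a)}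
      ≤ ENNReal.ofReal (Real.exp (-(m * a / 2))) := by
  set p := risk D f with hp
  set μ := Measure.pi fun _ : Fin m => D
  rcases (risk_nonneg (D := D) (f := f)).eq_or_lt with h0 | hpos
  · have : {S : Fin m → X × Bool | freq f S < p - √(p * a)} = ∅ := by
      ext S
      have := freq_nonneg (f := f) S
      simp [hp, ← h0, this]
    rw [this]
    simp
  rw [← hp] at hpos
  -- The optimal exponent: the threshold becomes `p - p * t`, and the Chernoff exponent `m * (t * (p
  -- - p * t) - (t - t ^ 2 / 2) * p)` equals `-(m * a / 2)`.
  set t := √(a / p) with ht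
  have ht0 : 0 ≤ t := Real.sqrt_nonneg _
  have ht2 : t ^ 2 * p = a := by
    rw [ht, Real.sq_sqrt (by positivity)]
    field_simp
  have hs : √(p * a) = p * t := by
    rw [← ht2, show p * (t ^ 2 * p) = (p * t) ^ 2 by ring, Real.sqrt_sq (by positivity)]
  -- This follows from `exp t ≥ 1 + t + t ^ 2 / 2` and `(1 + t + t ^ 2 / 2) * (1 - t + t ^ 2 / 2) =
  -- 1 + t ^ 4 / 4`.
  have hexp : Real.exp (-t) ≤ 1 - t + t ^ 2 / 2 := by
    rw [Real.exp_neg, inv_le_iff_one_le_mul₀ (Real.exp_pos t)]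
    have h1 := Real.quadratic_le_exp_of_nonneg ht0
    have h2 : 0 ≤ 1 - t + t ^ 2 / 2 := by nlinarith [sq_nonneg (t - 1)]
    nlinarith [mul_le_mul_of_nonneg_left h1 h2, sq_nonneg (t ^ 2)]
  let g : X × Bool → ℝ := fun z => Real.exp (-t * ind (f z.1 != z.2))
  have hgm : Measurable g := ((measurable_ind_loss hf).const_mul _).exp
  have hg0 : ∀ z, 0 ≤ g z := fun z => (Real.exp_pos _).le
  have hg1 : ∀ z, g z ≤ 1 := fun z => by
    refine Real.exp_le_one_iff.2 ?_
    have := mul_nonneg ht0 (ind_nonneg (f z.1 != z.2))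
    linarith
  have hgint : ∫ z, g z ∂D ≤ Real.exp (-((t - t ^ 2 / 2) * p)) := by
    have hg : ∀ z, g z = 1 - (1 - Real.exp (-t)) * ind (f z.1 != z.2) := fun z => by
      simp only [g]
      cases f z.1 != z.2 <;> simp [ind]
    simp_rw [hg]
    rw [integral_sub (integrable_const _) ((integrable_ind_loss hf).const_mul _),
      integral_const_mul, integral_ind_loss hf, ← hp]
    simp only [integral_const, probReal_univ, smul_eq_mul, mul_one]
    have h1 := Real.add_one_le_exp (-((t - t ^ 2 / 2) * p))
    have h2 : (t - t ^ 2 / 2) * p ≤ (1 - Real.exp (-t)) * p := by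
      refine mul_le_mul_of_nonneg_right ?_ hpos.le
      linarith
    linarith
  have hGm : Measurable fun S : Fin m → X × Bool => ∏ i, g (S i) :=
    Finset.measurable_prod _ fun i _ => hgm.comp (measurable_pi_apply i)
  have hGint : Integrable (fun S : Fin m → X × Bool => ∏ i, g (S i)) μ := by
    refine Integrable.of_bound hGm.aestronglyMeasurable 1
      (Filter.Eventually.of_forall fun S => ?_)
    rw [Real.norm_eq_abs, abs_of_nonneg (Finset.prod_nonneg fun i _ => hg0 _)]
    exact Finset.prod_le_one (fun i _ => hg0 _) fun i _ => hg1 _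
  have hmarkov := mul_meas_ge_le_integral_of_nonneg (μ := μ)
    (Filter.Eventually.of_forall fun S : Fin m → X × Bool => Finset.prod_nonneg fun i _ => hg0 (S i))
    hGint (Real.exp (-t * (m * (p - p * t))))
  rw [integral_fintype_prod_eq_pow, Fintype.card_fin] at hmarkov
  have hpow : (∫ z, g z ∂D) ^ m ≤ Real.exp (m * -((t - t ^ 2 / 2) * p)) := by
    rw [Real.exp_nat_mul]
    exact pow_le_pow_left₀ (integral_nonneg hg0) hgint m
  have hsub : {S : Fin m → X × Bool | freq f S < p - √(p * a)}
      ⊆ {S | Real.exp (-t * (m * (p - p * t))) ≤ ∏ i, g (S i)} := by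
    intro S hS
    have hS' : freq f S < p - √(p * a) := hS
    rw [hs] at hS'
    change Real.exp _ ≤ ∏ i, Real.exp (-t * ind (loss f S i))
    rw [← Real.exp_sum, ← Finset.mul_sum, ← mul_freq, Real.exp_le_exp, neg_mul, neg_mul,
      neg_le_neg_iff]
    gcongr
  refine (measure_mono hsub).trans ?_
  rw [← ofReal_measureReal]
  refine ENNReal.ofReal_le_ofReal ?_
  refine le_of_mul_le_mul_left ((hmarkov.trans hpow).trans (le_of_eq ?_))
    (Real.exp_pos (-t * (m * (p - p * t))))
  rw [← Real.exp_add, ← ht2]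
  ring_nf

/-- Markov's inequality for the error frequency. -/
lemma measure_lt_freq_le {X : Type*} [MeasurableSpace X] (D : Measure (X × Bool))
    [IsProbabilityMeasure D] {f : X → Bool} {m : ℕ} (hf : Measurable f)
    (hm : 0 < m) {a : ℝ} (ha : 0 < a) (hfa : risk D f ≤ a) :
    (Measure.pi fun _ : Fin m => D) {S | 2 * a < freq f S} ≤ 1 / 2 := by
  set μ := Measure.pi fun _ : Fin m => D
  have hint : ∀ i : Fin m, Integrable (fun S : Fin m → X × Bool => ind (loss f S i)) μ := fun i =>
    (measurePreserving_eval (fun _ : Fin m => D) i).integrable_comp_of_integrable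
      (integrable_ind_loss hf)
  have hfreq : ∫ S : Fin m → X × Bool, freq f S ∂μ = risk D f := by
    simp only [freq]
    rw [integral_div, integral_finsetSum _ fun i _ => hint i]
    have : ∀ i : Fin m, ∫ S : Fin m → X × Bool, ind (loss f S i) ∂μ = risk D f := fun i => by
      rw [← integral_ind_loss hf]
      exact integral_comp_eval (μ := fun _ : Fin m => D) (i := i)
        (measurable_ind_loss hf).aestronglyMeasurable
    simp only [this, Finset.sum_const, Finset.card_univ, Fintype.card_fin, nsmul_eq_mul]
    rw [mul_div_cancel_left₀]
    positivity
  have h := mul_meas_ge_le_integral_of_nonneg (μ := μ)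
    (Filter.Eventually.of_forall fun S : Fin m → X × Bool => freq_nonneg (f := f) S)
    ((integrable_finsetSum _ fun i _ => hint i).div_const _) (2 * a)
  change _ ≤ ∫ S : Fin m → X × Bool, freq f S ∂μ at h
  rw [hfreq] at h
  have h2 : μ.real {S : Fin m → X × Bool | 2 * a ≤ freq f S} ≤ 1 / 2 := by
    change 2 * a * μ.real {S : Fin m → X × Bool | 2 * a ≤ freq f S} ≤ _ at h
    nlinarith
  refine (measure_mono (t := {S : Fin m → X × Bool | 2 * a ≤ freq f S})
    fun S (hS : 2 * a < freq f S) => hS.le).trans ?_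
  rw [← ofReal_measureReal]
  refine (ENNReal.ofReal_le_ofReal h2).trans (le_of_eq ?_)
  rw [ENNReal.ofReal_div_of_pos two_pos]
  simp

/-! ### From one bad sample to a double deviation. -/

lemma half_le_measure_of_compl_le {α : Type*} [MeasurableSpace α] {μ : Measure α}
    [IsProbabilityMeasure μ] {s : Set α} (h : μ sᶜ ≤ 1 / 2) : 1 / 2 ≤ μ s := by
  have h1 : (1 : ℝ≥0∞) ≤ μ s + μ sᶜ := by
    rw [← measure_univ (μ := μ), ← Set.union_compl_self s]
    exact measure_union_le _ _
  have h2 : (1 : ℝ≥0∞) ≤ μ s + 1 / 2 := h1.trans (by gcongr)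
  refine (ENNReal.add_le_add_iff_right (show (1 / 2 : ℝ≥0∞) ≠ ∞ by simp)).1 ?_
  rwa [ENNReal.add_halves]

/-- The squared differences of 0-1 losses count the positions of disagreement, at most the total
number of errors in the two samples. -/
lemma deviates_of_sq_ge {X : Type*} {f : X → Bool} {m : ℕ} {S S' : Fin m → X × Bool} {e : ℝ} (hm : 0 < m) (he : 0 ≤ e)
    (hne : freq f S ≠ freq f S')
    (h : (freq f S + freq f S') * e ≤ (freq f S' - freq f S) ^ 2) :
    Deviates (m * e) (loss f S) (loss f S') := by
  have hm' : (0 : ℝ) < m := by exact_mod_cast hm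
  have hsum : ∑ i, (ind (loss f S' i) - ind (loss f S i)) = m * (freq f S' - freq f S) := by
    rw [Finset.sum_sub_distrib, mul_sub, mul_freq, mul_freq]
  have hsq : ∑ i, (ind (loss f S' i) - ind (loss f S i)) ^ 2 ≤ m * (freq f S + freq f S') := by
    rw [mul_add, mul_freq, mul_freq, ← Finset.sum_add_distrib]
    refine Finset.sum_le_sum fun i _ => ?_
    cases loss f S' i <;> cases loss f S i <;> norm_num [ind]
  refine ⟨?_, ?_⟩
  · rw [hsum]
    exact mul_ne_zero hm'.ne' (sub_ne_zero.2 hne.symm)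
  · rw [hsum]
    calc m * e * _ ≤ m * e * (m * (freq f S + freq f S')) := by gcongr
      _ = m ^ 2 * ((freq f S + freq f S') * e) := by ring
      _ ≤ m ^ 2 * (freq f S' - freq f S) ^ 2 := by gcongr
      _ = _ := by ring

/-- With `p = r ^ 2` and `e = k ^ 2`, the gap `q' - q` is at least `r * k / 2`, and `q ≥ 0` forces
`k < r`. Writing `q + q' = 2 * q + (q' - q)` reduces the claim to monotonicity of `t * (t - k ^ 2 /
8)` in the gap `t`. -/
lemma sq_sub_ge_of_lower {p q q' e : ℝ} (hp : 0 ≤ p) (he : 0 < e) (hq : 0 ≤ q)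
    (h : q < p - √(p * e)) (h' : p - √(p * (e / 4)) ≤ q') :
    q ≠ q' ∧ (q + q') * (e / 8) ≤ (q' - q) ^ 2 := by
  obtain ⟨r, hr, rfl⟩ : ∃ r, 0 ≤ r ∧ p = r ^ 2 := ⟨√p, Real.sqrt_nonneg _, (Real.sq_sqrt hp).symm⟩
  obtain ⟨k, hk, rfl⟩ : ∃ k, 0 < k ∧ e = k ^ 2 :=
    ⟨√e, Real.sqrt_pos.2 he, (Real.sq_sqrt he.le).symm⟩
  rw [show r ^ 2 * k ^ 2 = (r * k) ^ 2 by ring, Real.sqrt_sq (by positivity)] at h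
  rw [show r ^ 2 * (k ^ 2 / 4) = (r * k / 2) ^ 2 by ring, Real.sqrt_sq (by positivity)] at h'
  have hrk : k < r := by
    by_contra! hle
    nlinarith
  have hpos : 0 < r * k := mul_pos (hk.trans hrk) hk
  refine ⟨by intro h; linarith, ?_⟩
  have ht : r * k / 2 ≤ q' - q := by linarith
  have hk2 : k ^ 2 ≤ r * k := by
        nlinarith [Real.log_pos one_lt_two]
  have h1 : (r * k / 2) * (r * k / 2 - k ^ 2 / 8) ≤ (q' - q) * (q' - q - k ^ 2 / 8) :=
    mul_le_mul ht (by linarith) (by linarith) (by linarith)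
  have h2 : q * (k ^ 2 / 4) ≤ (r ^ 2 - r * k) * (k ^ 2 / 4) := by gcongr
  have h3 : 0 ≤ r * k * k ^ 2 := by positivity
  nlinarith

lemma sq_sub_ge_of_upper {q q' e : ℝ} (he : 0 < e) (h : 3 * e < q) (h' : q' ≤ 2 * e) :
    q ≠ q' ∧ (q + q') * (e / 8) ≤ (q' - q) ^ 2 := by
  refine ⟨by intro h; linarith, ?_⟩
  have h1 : e * (7 * e / 8) ≤ (q - q') * (q - q' - e / 8) :=
    mul_le_mul (by linarith) (by linarith) (by linarith) (by linarith)
  have h2 : q' * (e / 4) ≤ 2 * e * (e / 4) := by gcongr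
  nlinarith [mul_pos he he]

lemma le_add_sqrt_of_sub_sqrt_le {p q e : ℝ} (hp : 0 ≤ p) (he : 0 ≤ e) (hq : 0 ≤ q)
    (h : p - √(p * e) ≤ q) : p ≤ q + √(q * e) + e := by
  rw [Real.sqrt_mul hp] at h
  rw [Real.sqrt_mul hq]
  have h1 := Real.sq_sqrt hp
  have h2 := Real.sq_sqrt hq
  have h3 := Real.sq_sqrt he
  have h4 := Real.sqrt_nonneg p
  have h5 := Real.sqrt_nonneg q
  have h6 := Real.sqrt_nonneg e
  generalize √p = r at *
  generalize √q = w at *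
  generalize √e = k at *
  subst h1 h2 h3
  -- In terms of square roots the hypothesis is `r ^ 2 - r * k ≤ w ^ 2`. If `r ≤ w + k`, bound `r *
  -- k` by `(w + k) * k`; otherwise `r * (r - k) > w ^ 2`, a contradiction.
  rcases le_or_gt r (w + k) with hle | hlt
  · nlinarith
  · nlinarith

lemma le_nine_mul_of_le {p q e : ℝ} (he : 0 ≤ e) (h : p ≤ q + √(q * e) + e)
    (hq : q ≤ 3 * e) : p ≤ 9 * e := by
  have : √(q * e) ≤ 2 * e := by
    rw [Real.sqrt_le_left (by positivity)]
    nlinarith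
  linarith

/-- Relative uniform convergence for a class of finite VC dimension. -/
lemma measure_relative_deviation_le {X : Type*} [MeasurableSpace X] {F : Set (X → Bool)}
    (D : Measure (X × Bool)) [IsProbabilityMeasure D] (hF : MeasurablyRealizes D.fst F)
    (hFm : ∀ f ∈ F, Measurable f) {d : ℕ} (hd : vcDimension F ≤ d) {e : ℝ} (he : 0 < e)
    (he1 : e ≤ 1) {m : ℕ} (hm : 8 * Real.log 2 ≤ m * e) :
    (Measure.pi fun _ : Fin m => D) {S | ∃ f ∈ F, freq f S < risk D f - √(risk D f * e) ∨
      (risk D f ≤ e ∧ 3 * e < freq f S)}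
      ≤ ENNReal.ofReal (4 * (64 / e) ^ d * Real.exp (-(m * e / 32))) := by
  have hlog := Real.log_pos one_lt_two
  have hm0 : 0 < m := by
    rcases Nat.eq_zero_or_pos m with rfl | h
    · simp at hm; linarith
    · exact h
  have hghost := measure_le_two_mul_prod (Measure.pi fun _ : Fin m => D)
    (A := {S | ∃ f ∈ F, freq f S < risk D f - √(risk D f * e) ∨
      (risk D f ≤ e ∧ 3 * e < freq f S)})
    (E := doubleDeviation F (m * (e / 8))) (by
      rintro S ⟨f, hf, h | ⟨hre, hfe⟩⟩
      · refine ⟨{S' | risk D f - √(risk D f * (e / 4)) ≤ freq f S'},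
          half_le_measure_of_compl_le ?_, fun S' hS' => ⟨f, hf, ?_⟩⟩
        -- The choice `e / 4` halves the allowed deviation, leaving a gap of half of `√(risk * e)`;
        -- the failure probability `exp (-(m * e / 8))` is at most `1 / 2` by `hm`.
        · have h1 := measure_freq_lt_le D (hFm f hf) m (a := e / 4) (by positivity)
          rw [Set.compl_ofPred]
          simp only [not_le]
          refine h1.trans ?_
          have h2 : Real.exp (-(m * (e / 4) / 2)) ≤ 1 / 2 := by
            rw [one_div, ← Real.exp_log (two_pos), ← Real.exp_neg, Real.exp_le_exp,
              Real.exp_log two_pos]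
            linarith
          refine (ENNReal.ofReal_le_ofReal h2).trans (le_of_eq ?_)
          rw [ENNReal.ofReal_div_of_pos two_pos]
          simp
        · obtain ⟨hne, hsq⟩ := sq_sub_ge_of_lower risk_nonneg he (freq_nonneg S) h hS'
          exact deviates_of_sq_ge hm0 (by positivity) hne hsq
      · refine ⟨{S' | freq f S' ≤ 2 * e}, half_le_measure_of_compl_le ?_,
          fun S' hS' => ⟨f, hf, ?_⟩⟩
        · rw [Set.compl_ofPred]
          simp only [not_le]
          exact measure_lt_freq_le D (hFm f hf) hm0 he hre
        · obtain ⟨hne, hsq⟩ := sq_sub_ge_of_upper he hfe hS'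
          exact deviates_of_sq_ge hm0 (by positivity) hne hsq)
  have hN := measure_doubleDeviation_le (m := m) D hF (fun x => card_realized_le hd x)
    (c := m * (e / 8)) (by positivity)
  rw [Fintype.card_sum, Fintype.card_fin] at hN
  -- With `l = e / 64` the growth function costs `exp (m * e / 32)`, half of the exponent `m * e /
  -- 16` gained from the signs.
  have hB := sum_choose_le_exp (m + m) d (l := e / 64) (by positivity) (by linarith)
  refine hghost.trans ((mul_le_mul_right hN 2).trans ?_)
  rw [← ENNReal.ofReal_ofNat 2, ← ENNReal.ofReal_mul (by norm_num)]
  refine ENNReal.ofReal_le_ofReal ?_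
  calc (2 : ℝ) * (((∑ k ∈ Finset.Iic d, (m + m).choose k : ℕ) : ℝ)
        * (2 * Real.exp (-(m * (e / 8) / 2))))
      ≤ 2 * (((1 / (e / 64)) ^ d * Real.exp (((m + m : ℕ) : ℝ) * (e / 64)))
        * (2 * Real.exp (-(m * (e / 8) / 2)))) := by gcongr
    _ = 4 * (64 / e) ^ d * (Real.exp (((m + m : ℕ) : ℝ) * (e / 64))
        * Real.exp (-(m * (e / 8) / 2))) := by
      rw [one_div_div]; ring
    _ = _ := by
      rw [← Real.exp_add]
      push_cast
      ring_nf

/-! ### The learning rule and the sample size. -/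

lemma countLE_mono {X : Type*} {𝒯 : Set (X → X)} {e e' : (X → X) → ℝ} {c c' : ℝ}
    (h : ∀ T ∈ 𝒯, e T ≤ c → e' T ≤ c') : countLE 𝒯 e c ≤ countLE 𝒯 e' c' := by
  refine ENNReal.tsum_le_tsum fun T => ?_
  by_cases h1 : e T ≤ c
  · simp [h1, h T T.2 h1]
  · simp [h1]

lemma measurable_of_mem_compClass {X : Type*} [MeasurableSpace X] {H : Set (X → Bool)}
    {𝒯 : Set (X → X)} (hH : ∀ h ∈ H, Measurable h) (hT : ∀ T ∈ 𝒯, Measurable T) :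
    ∀ f ∈ compClass H 𝒯, Measurable f := by
  rintro _ ⟨h, hh, T, hT', rfl⟩
  exact (hH h hh).comp (hT T hT')

lemma eq_of_vcDimension_eq_zero {X : Type*} {F : Set (X → Bool)} (hd : vcDimension F ≤ 0)
    {f g : X → Bool} (hf : f ∈ F) (hg : g ∈ F) : f = g := by
  by_contra hne
  obtain ⟨x, hx⟩ := Function.ne_iff.1 hne
  have hs : ClassShatters F {x} := by
    intro b
    by_cases h : f x = b x
    · exact ⟨f, hf, by simpa using h⟩
    · refine ⟨g, hg, ?_⟩
      have : g x = b x := by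
        cases h1 : f x <;> cases h2 : g x <;> cases h3 : b x <;> simp_all
      simpa using this
  have := hs.card_le (d := 0) (by simpa using hd)
  simp at this

/-- The learning rule is competitive if the error frequencies are close to the risks. -/
lemma iSup_countLE_le_of_mem_learningRule {X : Type*} [MeasurableSpace X] {H : Set (X → Bool)}
    {𝒯 : Set (X → X)} {D : Measure (X × Bool)} {ε : ℝ} {m : ℕ} {S : Fin m → X × Bool}
    (hlow : ∀ f ∈ compClass H 𝒯, risk D f ≤ ε / 3 → freq f S ≤ ε)
    (hupp : ∀ f ∈ compClass H 𝒯, freq f S ≤ ε → risk D f ≤ 3 * ε)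
    {hhat : X → Bool} (hhat_mem : hhat ∈ learningRule H 𝒯 ε S) :
    (⨆ hstar ∈ H, countLE 𝒯 (err D hstar) (ε / 3)) ≤ countLE 𝒯 (err D hhat) (3 * ε) := by
  refine iSup₂_le fun hstar hH => ?_
  calc countLE 𝒯 (err D hstar) (ε / 3) ≤ countLE 𝒯 (empErr S hstar) ε :=
        countLE_mono fun T hT h => by
          rw [empErr_eq_freq]
          exact hlow _ ⟨hstar, hH, T, hT, rfl⟩ h
    _ ≤ countLE 𝒯 (empErr S hhat) ε := hhat_mem.2 hH
    _ ≤ _ := countLE_mono fun T hT h => by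
          rw [empErr_eq_freq] at h
          exact hupp _ ⟨hhat, hhat_mem.1, T, hT, rfl⟩ h

lemma risk_le_one {X : Type*} [MeasurableSpace X] (D : Measure (X × Bool))
    [IsProbabilityMeasure D] (f : X → Bool) : risk D f ≤ 1 := measureReal_le_one

/-- After taking logarithms, `4` costs at most `2 * d * log (1 / ε)` and `(192 / ε) ^ d` at most `9
* d * log (1 / ε)`, using `ε ≤ 1 / 2` and `d ≥ 1`. The exponent is `m * ε / 96`, whence `1056 = 96 *
11`. -/
lemma sample_size_bound {d m : ℕ} {ε δ : ℝ} (hε : 0 < ε) (hε2 : ε ≤ 1 / 2) (hδ : 0 < δ)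
    (hδ1 : δ < 1) (hd : 1 ≤ d)
    (hm : 1056 * ((d * Real.log (1 / ε) + Real.log (1 / δ)) / ε) ≤ m) :
    4 * (64 / (ε / 3)) ^ d * Real.exp (-(m * (ε / 3) / 32)) ≤ δ := by
  have hm' : 1056 * (d * Real.log (1 / ε) + Real.log (1 / δ)) ≤ m * ε := by
    rwa [← mul_div_assoc, div_le_iff₀ hε] at hm
  have hl2 := Real.log_pos one_lt_two
  have hlε : Real.log 2 ≤ Real.log (1 / ε) :=
    Real.log_le_log two_pos (by rw [le_div_iff₀ hε]; linarith)
  have hd' : (1 : ℝ) ≤ d := by exact_mod_cast hd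
  have h192 : Real.log (64 / (ε / 3)) ≤ 9 * Real.log (1 / ε) := by
    have h1 : (64 : ℝ) / (ε / 3) = 192 * (1 / ε) := by field_simp; norm_num
    have h2 : Real.log 192 ≤ 8 * Real.log 2 := by
      rw [show (8 : ℝ) * Real.log 2 = ((8 : ℕ) : ℝ) * Real.log 2 by norm_num, ← Real.log_pow]
      exact Real.log_le_log (by norm_num) (by norm_num)
    rw [h1, Real.log_mul (by norm_num) (by positivity)]
    linarith
  have h4 : Real.log 4 ≤ 2 * (d * Real.log (1 / ε)) := by
    rw [show (4 : ℝ) = 2 ^ 2 by norm_num, Real.log_pow]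
    push_cast
    nlinarith
  have h5 : d * Real.log (64 / (ε / 3)) ≤ d * (9 * Real.log (1 / ε)) := by gcongr
  have hL : 0 ≤ Real.log (1 / δ) := Real.log_nonneg (by rw [le_div_iff₀ hδ]; linarith)
  rw [← Real.log_le_log_iff (by positivity) hδ, Real.log_mul (by positivity) (by positivity),
    Real.log_mul (by norm_num) (by positivity), Real.log_pow, Real.log_exp]
  rw [one_div δ, Real.log_inv] at hm' hL
  linarith

end TransformLearning

/- The failure event is bounded in outer measure, so the conclusions hold simultaneously on a
measurable event of probability at least `1 - δ`. -/
theorem theorem4 :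
    ∃ C : ℝ, 0 < C ∧
      ∀ (X : Type*) [MeasurableSpace X] (H : Set (X → Bool)) (𝒯 : Set (X → X))
        (D : Measure (X × Bool)) [IsProbabilityMeasure D],
        (∀ h ∈ H, Measurable h) → (∀ T ∈ 𝒯, Measurable T) → 𝒯.Countable →
        MeasurablyRealizes D.fst (compClass H 𝒯) →
        ∀ d : ℕ, vcDimension (compClass H 𝒯) = d →
        ∀ ε δ : ℝ, 0 < ε → ε < 1 → 0 < δ → δ < 1 →
        ∀ m : ℕ, C * ((d * Real.log (1 / ε) + Real.log (1 / δ)) / ε) ≤ m →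
          (Measure.pi fun _ : Fin m => D)
            {S | ¬ ∀ hhat ∈ learningRule H 𝒯 ε S,
              (⨆ hstar ∈ H, countLE 𝒯 (err D hstar) (ε / 3)) ≤ countLE 𝒯 (err D hhat) (3 * ε) ∧
              (ε ≤ 1 / 2 → ∀ T ∈ 𝒯,
                err D hhat T ≤
                  empErr S hhat T + Real.sqrt (empErr S hhat T * (ε / 3)) + ε / 3)}
            ≤ ENNReal.ofReal δ := by
  refine ⟨1056, by norm_num, ?_⟩
  intro X _ H 𝒯 D _ hH hT _ hF d hd ε δ hε hε1 hδ hδ1 m hm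
  have hFm := measurable_of_mem_compClass hH hT
  have hL : 0 ≤ Real.log (1 / δ) := Real.log_nonneg (by rw [le_div_iff₀ hδ]; linarith)
  have hm' : 1056 * (d * Real.log (1 / ε) + Real.log (1 / δ)) ≤ m * ε := by
    rwa [← mul_div_assoc, div_le_iff₀ hε] at hm
  -- For `ε > 1 / 2` the level `3 * ε` exceeds 1, so every transformation is counted for `hhat`.
  rcases lt_or_ge (1 / 2) ε with hε2 | hε2
  · refine le_trans (measure_mono (t := ∅) fun S hS => hS fun hhat _ =>
      ⟨iSup₂_le fun hstar _ => countLE_mono fun T _ _ => ?_, fun h => absurd h hε2.not_ge⟩) (by simp)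
    rw [err_eq_risk]
    linarith [risk_le_one D (hhat ∘ T)]
  -- For `d = 0` the sample size is governed by `log (1 / δ)` alone, which for `δ` near 1 absorbs
  -- neither the factor 4 nor the ghost-sample requirement. But then the class has at most one
  -- member, and Chernoff applies to it directly.
  rcases Nat.eq_zero_or_pos d with rfl | hd0
  · have heq : ∀ f ∈ compClass H 𝒯, ∀ g ∈ compClass H 𝒯, f = g := fun f hf g hg =>
      eq_of_vcDimension_eq_zero hd.le hf hg
    rcases (compClass H 𝒯).eq_empty_or_nonempty with hempty | ⟨f, hf⟩
    · have hno : ∀ h ∈ H, ∀ T ∈ 𝒯, False := fun h hh T hT' => by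
        have : h ∘ T ∈ compClass H 𝒯 := ⟨h, hh, T, hT', rfl⟩
        simp [hempty] at this
      exact le_trans (measure_mono (t := ∅) fun S hS => hS fun hhat hhat_mem =>
        ⟨iSup₂_le fun hstar _ => countLE_mono fun T hT' _ => (hno hhat hhat_mem.1 T hT').elim,
          fun _ T hT' => (hno hhat hhat_mem.1 T hT').elim⟩) (by simp)
    · refine (measure_mono (t := {S | freq f S < risk D f - √(risk D f * (ε / 3))}) ?_).trans
        ((measure_freq_lt_le D (hFm f hf) m (by positivity)).trans (ENNReal.ofReal_le_ofReal ?_))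
      · intro S hS
        by_contra hS'
        refine hS fun hhat hhat_mem =>
          ⟨iSup₂_le fun hstar hstar_mem => countLE_mono fun T hT' h => ?_, fun _ T hT' => ?_⟩
        · rw [err_eq_risk, heq _ ⟨hhat, hhat_mem.1, T, hT', rfl⟩ _ ⟨hstar, hstar_mem, T, hT', rfl⟩]
          rw [err_eq_risk] at h
          linarith
        · rw [err_eq_risk, empErr_eq_freq, heq _ ⟨hhat, hhat_mem.1, T, hT', rfl⟩ f hf]
          exact le_add_sqrt_of_sub_sqrt_le risk_nonneg (by positivity) (freq_nonneg S)
            (not_lt.1 hS')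
      · rw [← Real.le_log_iff_exp_le hδ]
        rw [one_div δ, Real.log_inv] at hm' hL
        simp only [Nat.cast_zero, zero_mul, zero_add] at hm'
        linarith
  · have hlε : Real.log 2 ≤ Real.log (1 / ε) :=
      Real.log_le_log two_pos (by rw [le_div_iff₀ hε]; linarith)
    have hd' : (1 : ℝ) ≤ d := by exact_mod_cast hd0
    have hme : 8 * Real.log 2 ≤ m * (ε / 3) := by
      have : Real.log 2 ≤ d * Real.log (1 / ε) := by
        nlinarith [Real.log_pos one_lt_two]
      have := Real.log_pos one_lt_two
      linarith
    refine (measure_mono ?_).trans ((measure_relative_deviation_le D hF hFm hd.le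
      (e := ε / 3) (by positivity) (by linarith) hme).trans
      (ENNReal.ofReal_le_ofReal (sample_size_bound hε hε2 hδ hδ1 hd0 hm)))
    intro S hS
    by_contra hS'
    simp only [Set.mem_ofPred_eq, not_exists, not_and, not_or, not_lt] at hS'
    have hlow : ∀ f ∈ compClass H 𝒯, risk D f ≤ freq f S + √(freq f S * (ε / 3)) + ε / 3 :=
      fun f hf => le_add_sqrt_of_sub_sqrt_le risk_nonneg (by positivity) (freq_nonneg S)
        (hS' f hf).1
    refine hS fun hhat hhat_mem => ⟨iSup_countLE_le_of_mem_learningRule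
      (fun f hf h => ?_) (fun f hf h => ?_) hhat_mem, fun _ T hT' => ?_⟩
    -- At scale `e = ε / 3` the levels `e`, `3 * e`, `9 * e` are `ε / 3`, `ε`, `3 * ε`.
    · linarith [(hS' f hf).2 h]
    · linarith [le_nine_mul_of_le (by positivity) (hlow f hf) (by linarith : freq f S ≤ 3 * (ε / 3))]
    · rw [err_eq_risk, empErr_eq_freq]
      exact hlow _ ⟨hhat, hhat_mem.1, T, hT', rfl⟩
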